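/- Let $(\mathcal X,d_X)$ and $(\mathcal Y,d_Y)$ be bounded, complete, separable metric spaces, let $(X,Y)$ be a random element of $\mathcal X\times\mathcal Y$ on a probability space $(\Omega,\mathcal F,\mathbb P)$, with $P_X$ the law of $X$ and $P_{Y\mid X}$ a regular conditional distribution of $Y$ given $X$, and let $(X_1,Y_1),(X_2,Y_2),\dots$ be i.i.d. copies of $(X,Y)$. For each $n$ let $\{\Omega_m\}_{m=1}^{M_n}$ be a (deterministic) measurable partition of $\mathcal X$, which may depend on $n$, with $M_n/n\to0$. Assume: 1. The Fréchet mean $\mu_F=\arg\min_{\mu\in\mathcal Y}\mathbb E\,d_Y^2(Y,\mu)$ exists and is unique, and for $P_X$-almost every $x$ the conditional Fréchet mean $\mu_{F,x}=\arg\min_{\mu\in\mathcal Y}\int d_Y^2(y,\mu)\,P_{Y\mid X}(dy\mid x)$ exists and is unique. 2. There are constants $0<c_1\le c_2<\infty$, independent of $n$ and $m$, with $c_1/M_n\le \mathbb P(X\in\Omega_m)\le c_2/M_n$ for all $1\le m\le M_n$. 3. For almost every $y$ with respect to the law of $Y$, the map $\mu\mapsto d_Y^2(\mu,y)$ is geodesically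 convex on $\mathcal Y$, i.e. convex along every constant-speed minimizing geodesic $\gamma:[0,1]\to\mathcal Y$; and for every cell the cellwise Fréchet mean $\mu_{F,m}=\arg\min_{\mu\in\mathcal Y}\mathbb E[d_Y^2(Y,\mu)\mid X\in\Omega_m]$ exists and is unique. 4. $\displaystyle\sup_{1\le m\le M_n}\ \operatorname*{ess\,sup}_{x\in\Omega_m}\ d_Y(\mu_{F,m},\mu_{F,x})\to0$ as $n\to\infty$, where the essential supremum is with respect to $P_X$. Put $V_F=\mathbb E\,d_Y^2(Y,\mu_F)$, $V(x)=\int d_Y^2(y,\mu_{F,x})\,P_{Y\mid X}(dy\mid x)$ and $$\rho=1-\frac{\mathbb E[V(X)]}{V_F}.$$ Let $n_m=\#\{i\le n: X_i\in\Omega_m\}$, and let $\hat\mu_F$ and $\hat\mu_{F,m}$ be any sample Fréchet means, i.e. almost surely minimizers over $\mu\in\mathcal Y$ of $\frac1n\sum_{i\le n}d_Y^2(Y_i,\mu)$ and of $\frac1{n_m}\sum_{i\le n,\,X_i\in\Omega_m}d_Y^2(Y_i,\mu)$ respectively. Put $\hat V_F=\frac1n\sum_{i\le n}d_Y^2(Y_i,\hat\mu_F)$,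 $\hat V_m=\frac1{n_m}\sum_{i\le n,\,X_i\in\Omega_m}d_Y^2(Y_i,\hat\mu_{F,m})$ and $$\rho_n^{M_n}=1-\frac{\sum_{m=1}^{M_n}\frac{n_m}{n}\hat V_m}{\hat V_F},$$ where an empty cell contributes $0$ to the sum and a quotient with denominator $0$ is read as $0$. Then $$\rho_n^{M_n}-\rho\to0\quad\text{in probability as } n\to\infty.$$ -/

import Mathlib

open MeasureTheory ProbabilityTheory Filter Topology
open scoped ENNReal

noncomputable section

namespace FCC

/-! ### Fréchet means and variances -/

section Frechet

variable {𝒴 : Type*} [MetricSpace 𝒴]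

/-- The Fréchet functional `z ↦ ∫ d(y, z)² ν(dy)` of a law `ν`. Its value at a Fréchet mean of `ν`
is the Fréchet variance of `ν`. -/
def frechetFun [MeasurableSpace 𝒴] (ν : Measure 𝒴) (z : 𝒴) : ℝ :=
  ∫ y, dist y z ^ 2 ∂ν

/-- `μ` is the Fréchet mean of `ν`: it minimizes the Fréchet functional over the whole space,
and it is the only minimizer. -/
def IsUniqueFrechetMean [MeasurableSpace 𝒴] (ν : Measure 𝒴) (μ : 𝒴) : Prop :=
  (∀ z, frechetFun ν μ ≤ frechetFun ν z) ∧
    ∀ μ', (∀ z, frechetFun ν μ' ≤ frechetFun ν z) → μ' = μ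

/-- The empirical Fréchet functional of the observations `y i`, `i ∈ s`. -/
def sampleFrechetFun (s : Finset ℕ) (y : ℕ → 𝒴) (z : 𝒴) : ℝ :=
  (s.card : ℝ)⁻¹ * ∑ i ∈ s, dist (y i) z ^ 2

/-- `μ` is a sample Fréchet mean of the observations `y i`, `i ∈ s`, that is, a (not necessarily
unique) minimizer of the empirical Fréchet functional. -/
def IsSampleFrechetMean (s : Finset ℕ) (y : ℕ → 𝒴) (μ : 𝒴) : Prop :=
  ∀ z, sampleFrechetFun s y μ ≤ sampleFrechetFun s y z

/-- `γ`, restricted to `[0,1]`, is a (minimizing, constant speed) geodesic. -/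
def IsGeodesic (γ : ℝ → 𝒴) : Prop :=
  ∀ s ∈ Set.Icc (0 : ℝ) 1, ∀ t ∈ Set.Icc (0 : ℝ) 1,
    dist (γ s) (γ t) = |s - t| * dist (γ 0) (γ 1)

/-- `f` is geodesically convex: it is convex along every geodesic. -/
def GeodesicallyConvex (f : 𝒴 → ℝ) : Prop :=
  ∀ γ : ℝ → 𝒴, IsGeodesic γ → ∀ t ∈ Set.Icc (0 : ℝ) 1,
    f (γ t) ≤ (1 - t) * f (γ 0) + t * f (γ 1)

end Frechet

/-! ### Partitions of the predictor space -/

section Partition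

variable {𝒳 : Type*} [MeasurableSpace 𝒳]

/-- The sets `A m` form a measurable partition of the space. -/
structure IsMeasurablePartition {k : ℕ} (A : Fin k → Set 𝒳) : Prop where
  measurableSet : ∀ m, MeasurableSet (A m)
  disjoint : Pairwise fun m m' => Disjoint (A m) (A m')
  cover : ⋃ m, A m = Set.univ

/-- The partitions `A n` are balanced for the law `PX`: all cells of the `n`-th partition have
probability of exact order `1 / M n`, with constants independent of `n` and of the cell. -/
def IsBalanced (PX : Measure 𝒳) (M : ℕ → ℕ) (A : (n : ℕ) → Fin (M n) → Set 𝒳) : Prop :=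
  ∃ c₁ c₂ : ℝ, 0 < c₁ ∧ c₁ ≤ c₂ ∧
    ∀ n m, c₁ / M n ≤ PX.real (A n m) ∧ PX.real (A n m) ≤ c₂ / M n

end Partition

/-! ### The coefficient and its estimator -/

section Coefficient

variable {Ω 𝒳 𝒴 : Type*} [MeasurableSpace Ω] [MeasurableSpace 𝒳]
  [MetricSpace 𝒴] [MeasurableSpace 𝒴]

/-- The Fréchet correlation coefficient `1 - E[V(X)] / V_F`, where `μF` is the Fréchet mean of `Y`
and `μFx x` is the Fréchet mean of the conditional law of `Y` given `X = x`. -/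
def fcc [Nonempty 𝒴] [StandardBorelSpace 𝒴] (P : Measure Ω) [IsFiniteMeasure P]
    (X : Ω → 𝒳) (Y : Ω → 𝒴) (μF : 𝒴) (μFx : 𝒳 → 𝒴) : ℝ :=
  1 - (∫ ω, frechetFun (condDistrib Y X P (X ω)) (μFx (X ω)) ∂P) / frechetFun (P.map Y) μF

open scoped Classical in
/-- The indices `i < n` of the observations whose predictor `x i` falls in the cell `A`. -/
def cellIndices (n : ℕ) (x : ℕ → 𝒳) (A : Set 𝒳) : Finset ℕ :=
  (Finset.range n).filter fun i => x i ∈ A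

/-- The partition-based estimator `1 - (∑ₘ (nₘ / n) V̂ₘ) / V̂_F` computed from the first `n`
observations `(x i, y i)`, the partition `A`, a global sample Fréchet mean `μ` and cellwise sample
Fréchet means `μc`. A cell without observations contributes `0`. -/
def fccEstimator (n : ℕ) (x : ℕ → 𝒳) (y : ℕ → 𝒴) {k : ℕ} (A : Fin k → Set 𝒳)
    (μ : 𝒴) (μc : Fin k → 𝒴) : ℝ :=
  1 - (∑ m, ((cellIndices n x (A m)).card : ℝ) / n *
        sampleFrechetFun (cellIndices n x (A m)) y (μc m)) /
      sampleFrechetFun (Finset.range n) y μ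

end Coefficient

end FCC

end

/-! Both sample variances are minimal values of empirical functionals. Since `n_m` cancels, `∑
(n_m/n) V̂_m` equals `∑ₘ min_z Pₙ(cellLoss Aₘ z)`, where `Pₙ` is the empirical mean. A minimal value
moves by no more than the uniform deviation of the functional, so it is enough to control `∑ₘ |(Pₙ -
Q)(cellLoss Aₘ zₘ)|` uniformly in the centres `zₘ`; the sample means themselves need not converge.

For this, quantize the response by a simple function `q` that is close to the identity in `L¹`. Up
to an error `2D·d(y, q y)` free of the centres, where `D` is the diameter, each loss is a step
function on the sets `Aₘ × q⁻¹{b}` with coefficients at most `D²`. Each frequency deviates by at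
most `√(p/n)` in mean, and Cauchy–Schwarz over the cells gives `√(M/n)` for each of the finitely
many `b` (`exists_integrable_bound_cellLoss`). Markov's inequality then gives
`tendstoInMeasure_sum_empiricalMean_cellLoss`.

The pooled population minima tend to `E[V(X)]` by disintegration, continuity of the Fréchet
functional and dominated convergence (`tendsto_sum_integral_cellLoss`). The denominator is the case
of a single cell. The quotient is handled by continuity when `V_F ≠ 0` and directly when `V_F = 0`.
-/

namespace FCC

/-! ### Empirical means of independent observations -/

section Empirical

variable {E : Type*}

/-- The mean of `f` over the first `n` observations `s 0, …, s (n - 1)`. -/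
noncomputable def empiricalMean (n : ℕ) (s : ℕ → E) (f : E → ℝ) : ℝ :=
  (n : ℝ)⁻¹ * ∑ i ∈ Finset.range n, f (s i)

theorem empiricalMean_sub (n : ℕ) (s : ℕ → E) (f g : E → ℝ) :
    empiricalMean n s (fun e => f e - g e) = empiricalMean n s f - empiricalMean n s g := by
  simp [empiricalMean, Finset.sum_sub_distrib, mul_sub]

theorem empiricalMean_sum {ι : Type*} (t : Finset ι) (n : ℕ) (s : ℕ → E) (f : ι → E → ℝ) :
    empiricalMean n s (fun e => ∑ j ∈ t, f j e) = ∑ j ∈ t, empiricalMean n s (f j) := by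
  simp only [empiricalMean]
  rw [Finset.sum_comm, Finset.mul_sum]

theorem empiricalMean_const_mul (n : ℕ) (s : ℕ → E) (c : ℝ) (f : E → ℝ) :
    empiricalMean n s (fun e => c * f e) = c * empiricalMean n s f := by
  simp only [empiricalMean, ← Finset.mul_sum]
  ring

theorem abs_empiricalMean_le {n : ℕ} {s : ℕ → E} {f g : E → ℝ} (h : ∀ e, |f e| ≤ g e) :
    |empiricalMean n s f| ≤ empiricalMean n s g := by
  rw [empiricalMean, empiricalMean, abs_mul, abs_of_nonneg (by positivity : (0 : ℝ) ≤ (n : ℝ)⁻¹)]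
  gcongr
  exact (Finset.abs_sum_le_sum_abs _ _).trans (Finset.sum_le_sum fun i _ => h _)

variable {Ω : Type*} [MeasurableSpace Ω] [MeasurableSpace E] {P : Measure Ω}

/-- If `f` is within `e` of the step function `∑ b, c b • 1_{C b}`, then the deviation of its
empirical mean from its mean is controlled by `e` and by the empirical frequencies of the `C b`. -/
theorem abs_empiricalMean_sub_integral_le {ι : Type*} (t : Finset ι) {Q : Measure E}
    [IsFiniteMeasure Q] {f e : E → ℝ} {c : ι → ℝ} {C : ι → Set E} {B : ℝ}
    (hf : Integrable f Q) (he : Integrable e Q) (hC : ∀ b, MeasurableSet (C b))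
    (hc : ∀ b, |c b| ≤ B)
    (hfe : ∀ x, |f x - ∑ b ∈ t, c b * (C b).indicator 1 x| ≤ e x) (n : ℕ) (s : ℕ → E) :
    |empiricalMean n s f - ∫ x, f x ∂Q| ≤ empiricalMean n s e + ∫ x, e x ∂Q +
      B * ∑ b ∈ t, |empiricalMean n s ((C b).indicator 1) - Q.real (C b)| := by
  have hInd : ∀ b, Integrable (fun x => c b * (C b).indicator (1 : E → ℝ) x) Q := fun b =>
    ((integrable_const (1 : ℝ)).indicator (hC b)).const_mul _
  have hemp := abs_empiricalMean_le (n := n) (s := s) hfe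
  have hint : |∫ x, (f x - ∑ b ∈ t, c b * (C b).indicator (1 : E → ℝ) x) ∂Q| ≤ ∫ x, e x ∂Q := by
    refine abs_integral_le_integral_abs.trans (integral_mono_of_nonneg ?_ he ?_)
    · exact ae_of_all _ fun x => abs_nonneg _
    · exact ae_of_all _ hfe
  rw [empiricalMean_sub, empiricalMean_sum] at hemp
  rw [integral_sub hf (integrable_finsetSum _ fun b _ => hInd b),
    integral_finsetSum _ fun b _ => hInd b] at hint
  have hstep : |∑ b ∈ t, empiricalMean n s (fun x => c b * (C b).indicator (1 : E → ℝ) x) -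
      ∑ b ∈ t, ∫ x, c b * (C b).indicator (1 : E → ℝ) x ∂Q| ≤
      B * ∑ b ∈ t, |empiricalMean n s ((C b).indicator 1) - Q.real (C b)| := by
    rw [← Finset.sum_sub_distrib, Finset.mul_sum]
    refine (Finset.abs_sum_le_sum_abs _ _).trans (Finset.sum_le_sum fun b _ => ?_)
    rw [empiricalMean_const_mul, integral_const_mul, integral_indicator_one (hC b), ← mul_sub,
      abs_mul]
    exact mul_le_mul_of_nonneg_right (hc b) (abs_nonneg _)
  rw [abs_le] at *
  constructor <;> linarith [hemp.1, hemp.2, hint.1, hint.2, hstep.1, hstep.2]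

variable {Z : ℕ → Ω → E} {Q : Measure E}

theorem integrable_empiricalMean (hZ : ∀ i, AEMeasurable (Z i) P) (hQ : ∀ i, P.map (Z i) = Q)
    {f : E → ℝ} (hf : Integrable f Q) (n : ℕ) :
    Integrable (fun ω => empiricalMean n (fun i => Z i ω) f) P := by
  refine (integrable_finsetSum _ fun i _ => ?_).const_mul _
  rw [← hQ i] at hf
  exact hf.comp_aemeasurable (hZ i)

theorem integral_empiricalMean (hZ : ∀ i, AEMeasurable (Z i) P) (hQ : ∀ i, P.map (Z i) = Q)
    {f : E → ℝ} (hf : Integrable f Q) {n : ℕ} (hn : n ≠ 0) :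
    ∫ ω, empiricalMean n (fun i => Z i ω) f ∂P = ∫ x, f x ∂Q := by
  have hfi : ∀ i, Integrable (fun ω => f (Z i ω)) P := fun i =>
    (show Integrable f (P.map (Z i)) from hQ i ▸ hf).comp_aemeasurable (hZ i)
  have hI : ∀ i, ∫ ω, f (Z i ω) ∂P = ∫ x, f x ∂Q := fun i => by
    rw [← hQ i, integral_map (hZ i) (by rw [hQ i]; exact hf.aestronglyMeasurable)]
  simp only [empiricalMean]
  rw [integral_const_mul, integral_finsetSum _ fun i _ => hfi i]
  simp only [hI, Finset.sum_const, Finset.card_range, nsmul_eq_mul]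
  field_simp

/-- The mean absolute deviation of an empirical frequency is at most `√(p / n)`. -/
theorem integral_abs_empiricalMean_indicator_sub_le [IsProbabilityMeasure P]
    (hZ : ∀ i, AEMeasurable (Z i) P) (hQ : ∀ i, P.map (Z i) = Q) (hindep : iIndepFun Z P)
    {C : Set E} (hC : MeasurableSet C) {n : ℕ} (hn : n ≠ 0) :
    ∫ ω, |empiricalMean n (fun i => Z i ω) (C.indicator 1) - Q.real C| ∂P ≤
      √(Q.real C / n) := by
  have hQp : IsProbabilityMeasure Q := hQ 0 ▸ Measure.isProbabilityMeasure_map (hZ 0)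
  have hmeas : Measurable (C.indicator (1 : E → ℝ)) := measurable_one.indicator hC
  have hint : Integrable (C.indicator (1 : E → ℝ)) Q := (integrable_const (1 : ℝ)).indicator hC
  have hb : ∀ x, C.indicator (1 : E → ℝ) x ∈ Set.Icc (0 : ℝ) 1 := fun x => by
    by_cases hx : x ∈ C <;> simp [hx]
  set W : ℕ → Ω → ℝ := fun i ω => C.indicator (1 : E → ℝ) (Z i ω) with hW
  have hWm : ∀ i, AEMeasurable (W i) P := fun i => hmeas.comp_aemeasurable (hZ i)
  have hWL : ∀ i, MemLp (W i) 2 P := fun i =>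
    MemLp.of_bound (hWm i).aestronglyMeasurable 1 (ae_of_all _ fun ω => by
      rw [Real.norm_eq_abs, abs_le]; constructor <;> linarith [(hb (Z i ω)).1, (hb (Z i ω)).2])
  have hWI : ∀ i, ∫ ω, W i ω ∂P = Q.real C := fun i => by
    rw [← integral_indicator_one hC, ← hQ i, integral_map (hZ i) hmeas.aestronglyMeasurable]
  have hvar : ∀ i, variance (W i) P ≤ Q.real C := fun i => by
    -- For values in `[0, 1]` with mean `p`, the variance is at most `(1 - p) p ≤ p`.
    refine (variance_le_sub_mul_sub (a := 0) (b := 1) (ae_of_all _ fun ω => hb _) (hWm i)).trans ?_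
    rw [hWI]
    nlinarith [measureReal_nonneg (μ := Q) (s := C)]
  set U : Ω → ℝ := fun ω => empiricalMean n (fun i => Z i ω) (C.indicator 1) with hU
  have hUeq : U = fun ω => (n : ℝ)⁻¹ * (∑ i ∈ Finset.range n, W i) ω := by
    ext ω; simp [hU, empiricalMean, hW]
  have hUL : MemLp U 2 P := by
    rw [hUeq]; exact (memLp_finsetSum' _ fun i _ => hWL i).const_mul _
  have hUI : ∫ ω, U ω ∂P = Q.real C := by
    rw [hU, integral_empiricalMean hZ hQ hint hn, integral_indicator_one hC]
  have hUvar : variance U P ≤ Q.real C / n := by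
    rw [hUeq, variance_const_mul, IndepFun.variance_sum (fun i _ => hWL i)
      (fun i _ j _ hij => (hindep.indepFun hij).comp hmeas hmeas)]
    have hn' : (0 : ℝ) < n := by positivity
    calc (n : ℝ)⁻¹ ^ 2 * ∑ i ∈ Finset.range n, variance (W i) P
        ≤ (n : ℝ)⁻¹ ^ 2 * ∑ i ∈ Finset.range n, Q.real C := by gcongr; exact hvar _
      _ = Q.real C / n := by
        simp only [Finset.sum_const, Finset.card_range, nsmul_eq_mul]; field_simp
  have hDL : MemLp (fun ω => |U ω - Q.real C|) 2 P := (hUL.sub (memLp_const _)).abs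
  refine Real.le_sqrt_of_sq_le (le_trans ?_ hUvar)
  -- Jensen's inequality `(E|U - p|)² ≤ E(U - p)²`, read off from `0 ≤ Var |U - p|`.
  have h1 := variance_nonneg (fun ω => |U ω - Q.real C|) P
  rw [variance_eq_sub hDL] at h1
  rw [variance_eq_integral hUL.aemeasurable, hUI]
  simpa using h1

end Empirical

/-! ### Uniform convergence of the cellwise empirical Fréchet functionals -/

section Bounded

variable {𝒴 : Type*} [MetricSpace 𝒴] [BoundedSpace 𝒴]

theorem dist_le_diam_univ (y z : 𝒴) : dist y z ≤ Metric.diam (Set.univ : Set 𝒴) :=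
  Metric.dist_le_diam_of_mem (Bornology.IsBounded.all _) (Set.mem_univ _) (Set.mem_univ _)

theorem sq_dist_le_sq_diam_univ (y z : 𝒴) :
    dist y z ^ 2 ≤ Metric.diam (Set.univ : Set 𝒴) ^ 2 :=
  pow_le_pow_left₀ dist_nonneg (dist_le_diam_univ y z) 2

/-- The bound does not involve `z`; this makes the quantization error uniform over all centres. -/
theorem abs_sq_dist_sub_sq_dist_le (y y' z : 𝒴) :
    |dist y z ^ 2 - dist y' z ^ 2| ≤ 2 * Metric.diam (Set.univ : Set 𝒴) * dist y y' := by
  have h1 := abs_dist_sub_le y y' z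
  have h2 := dist_le_diam_univ y z
  have h3 := dist_le_diam_univ y' z
  rw [sq_sub_sq, abs_mul, abs_of_nonneg (by positivity)]
  exact mul_le_mul (by linarith) h1 (abs_nonneg _) (by positivity)

variable [SecondCountableTopology 𝒴] [MeasurableSpace 𝒴] [BorelSpace 𝒴]

theorem integrable_sq_dist (ν : Measure 𝒴) [IsFiniteMeasure ν] (z : 𝒴) :
    Integrable (fun y => dist y z ^ 2) ν :=
  Integrable.of_bound (by fun_prop) (Metric.diam (Set.univ : Set 𝒴) ^ 2) (ae_of_all _ fun y => by
    rw [Real.norm_of_nonneg (by positivity)]; exact sq_dist_le_sq_diam_univ _ _)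

theorem integrable_dist_simpleFunc (ν : Measure 𝒴) [IsFiniteMeasure ν] (q : SimpleFunc 𝒴 𝒴) :
    Integrable (fun y => dist y (q y)) ν :=
  Integrable.of_bound (measurable_id.dist q.measurable).aestronglyMeasurable
    (Metric.diam (Set.univ : Set 𝒴)) (ae_of_all _ fun y => by
      rw [Real.norm_of_nonneg dist_nonneg]; exact dist_le_diam_univ _ _)

/-- Projecting to the nearest of the first points of a dense sequence converges pointwise to the
identity, with errors bounded by the diameter. An `L¹` quantizer with finite range thus exists
without total boundedness. -/
theorem exists_simpleFunc_integral_dist_lt [Nonempty 𝒴] (ν : Measure 𝒴) [IsFiniteMeasure ν]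
    {ε : ℝ} (hε : 0 < ε) : ∃ q : SimpleFunc 𝒴 𝒴, ∫ y, dist y (q y) ∂ν < ε := by
  let q := SimpleFunc.nearestPt (TopologicalSpace.denseSeq 𝒴)
  have h : Tendsto (fun N => ∫ y, dist y (q N y) ∂ν) atTop (𝓝 (∫ _, (0 : ℝ) ∂ν)) := by
    refine tendsto_integral_of_dominated_convergence
      (fun _ => Metric.diam (Set.univ : Set 𝒴))
      (fun N => (integrable_dist_simpleFunc ν (q N)).aestronglyMeasurable)
      (integrable_const _) (fun N => ae_of_all _ fun y => ?_) (ae_of_all _ fun y => ?_)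
    · rw [Real.norm_of_nonneg dist_nonneg]; exact dist_le_diam_univ _ _
    · have := SimpleFunc.tendsto_nearestPt (e := TopologicalSpace.denseSeq 𝒴) (x := y)
        (TopologicalSpace.denseRange_denseSeq 𝒴 y)
      simpa using (tendsto_const_nhds (x := y)).dist this
  rw [integral_zero] at h
  obtain ⟨N, hN⟩ := (h.eventually_lt_const hε).exists
  exact ⟨q N, hN⟩

end Bounded

theorem IsMeasurablePartition.sum_indicator {𝒳 : Type*} [MeasurableSpace 𝒳] {k : ℕ}
    {A : Fin k → Set 𝒳} (hA : IsMeasurablePartition A) {m : Fin k} {x : 𝒳} (hx : x ∈ A m)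
    (c : Fin k → 𝒳 → ℝ) : ∑ j, (A j).indicator (c j) x = c m x := by
  rw [Finset.sum_eq_single m, Set.indicator_of_mem hx]
  · intro j _ hj
    exact Set.indicator_of_notMem (fun h => Set.disjoint_left.1 (hA.disjoint hj) h hx) _
  · simp

theorem IsMeasurablePartition.exists_mem {𝒳 : Type*} [MeasurableSpace 𝒳] {k : ℕ}
    {A : Fin k → Set 𝒳} (hA : IsMeasurablePartition A) (x : 𝒳) : ∃ m, x ∈ A m :=
  Set.mem_iUnion.1 (hA.cover ▸ Set.mem_univ x)

/-- The squared distance of the response to `z`, counted only if the predictor lies in `A`. -/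
noncomputable def cellLoss {𝒳 𝒴 : Type*} [MetricSpace 𝒴] (A : Set 𝒳) (z : 𝒴) (e : 𝒳 × 𝒴) : ℝ :=
  A.indicator (fun _ => dist e.2 z ^ 2) e.1

theorem cellLoss_nonneg {𝒳 𝒴 : Type*} [MetricSpace 𝒴] (A : Set 𝒳) (z : 𝒴) (e : 𝒳 × 𝒴) :
    0 ≤ cellLoss A z e :=
  Set.indicator_nonneg (fun _ _ => by positivity) _

theorem cellLoss_eq_indicator {𝒳 𝒴 : Type*} [MetricSpace 𝒴] (A : Set 𝒳) (z : 𝒴) :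
    cellLoss A z = (Prod.fst ⁻¹' A).indicator fun e : 𝒳 × 𝒴 => dist e.2 z ^ 2 := by
  ext e
  by_cases he : e.1 ∈ A <;> simp [cellLoss, he]

section Uniform

variable {Ω 𝒳 𝒴 : Type*} [MeasurableSpace Ω] {P : Measure Ω} [MeasurableSpace 𝒳]
  [MetricSpace 𝒴] [SecondCountableTopology 𝒴] [MeasurableSpace 𝒴] [BorelSpace 𝒴]

theorem measurable_cellLoss {A : Set 𝒳} (hA : MeasurableSet A) (z : 𝒴) :
    Measurable (cellLoss A z) := by
  rw [cellLoss_eq_indicator]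
  exact ((measurable_snd.dist measurable_const).pow_const 2).indicator (measurable_fst hA)

variable [BoundedSpace 𝒴]

theorem integrable_cellLoss (Q : Measure (𝒳 × 𝒴)) [IsFiniteMeasure Q] {A : Set 𝒳}
    (hA : MeasurableSet A) (z : 𝒴) : Integrable (cellLoss A z) Q :=
  Integrable.of_bound (measurable_cellLoss hA z).aestronglyMeasurable
    (Metric.diam (Set.univ : Set 𝒴) ^ 2) (ae_of_all _ fun e => by
      rw [Real.norm_of_nonneg (cellLoss_nonneg _ _ _)]
      exact Set.indicator_le_self' (fun _ _ => by positivity) e.1 |>.trans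
        (sq_dist_le_sq_diam_univ _ _))

/-- The deviations of all cellwise empirical Fréchet functionals, at arbitrary points, are
controlled by the quantization error of `q` and by finitely many empirical frequencies. -/
theorem sum_abs_empiricalMean_cellLoss_sub_le (Q : Measure (𝒳 × 𝒴)) [IsFiniteMeasure Q] {k : ℕ}
    {A : Fin k → Set 𝒳} (hA : IsMeasurablePartition A) (q : SimpleFunc 𝒴 𝒴) (n : ℕ)
    (s : ℕ → 𝒳 × 𝒴) (z : Fin k → 𝒴) :
    ∑ m, |empiricalMean n s (cellLoss (A m) (z m)) - ∫ e, cellLoss (A m) (z m) e ∂Q| ≤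
      empiricalMean n s (fun e => 2 * Metric.diam (Set.univ : Set 𝒴) * dist e.2 (q e.2)) +
      ∫ e, 2 * Metric.diam (Set.univ : Set 𝒴) * dist e.2 (q e.2) ∂Q +
      Metric.diam (Set.univ : Set 𝒴) ^ 2 * ∑ m, ∑ b ∈ q.range,
        |empiricalMean n s ((A m ×ˢ (q ⁻¹' {b})).indicator 1) - Q.real (A m ×ˢ (q ⁻¹' {b}))| := by
  set D := Metric.diam (Set.univ : Set 𝒴) with hD
  set e : 𝒳 × 𝒴 → ℝ := fun p => 2 * D * dist p.2 (q p.2) with he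
  set em : Fin k → 𝒳 × 𝒴 → ℝ := fun m p => (A m).indicator (fun _ => e p) p.1 with hem
  have hem_sum : ∀ p, ∑ m, em m p = e p := fun p => by
    obtain ⟨m, hm⟩ := hA.exists_mem p.1
    exact hA.sum_indicator hm (fun _ _ => e p)
  have heint : Integrable e Q := by
    refine Integrable.const_mul (Integrable.of_bound ?_ D (ae_of_all _ fun p => ?_)) _
    · exact (measurable_snd.dist (q.measurable.comp measurable_snd)).aestronglyMeasurable
    · rw [Real.norm_of_nonneg dist_nonneg]; exact dist_le_diam_univ _ _
  have hem_eq : ∀ m, em m = (Prod.fst ⁻¹' A m).indicator e := fun m => by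
    ext p; by_cases hp : p.1 ∈ A m <;> simp [hem, hp]
  have hemint : ∀ m, Integrable (em m) Q := fun m => by
    rw [hem_eq]; exact heint.indicator (measurable_fst (hA.measurableSet m))
  have hcell : ∀ m, |empiricalMean n s (cellLoss (A m) (z m)) - ∫ e, cellLoss (A m) (z m) e ∂Q| ≤
      empiricalMean n s (em m) + ∫ p, em m p ∂Q + D ^ 2 * ∑ b ∈ q.range,
        |empiricalMean n s ((A m ×ˢ (q ⁻¹' {b})).indicator 1) -
          Q.real (A m ×ˢ (q ⁻¹' {b}))| := fun m => by
    -- The centre `z m` enters only through the coefficients `dist b (z m) ^ 2`, which the diameter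
    -- bounds uniformly.
    refine abs_empiricalMean_sub_integral_le q.range (c := fun b => dist b (z m) ^ 2)
      (integrable_cellLoss Q (hA.measurableSet m) _) (hemint m)
      (fun b => (hA.measurableSet m).prod (q.measurableSet_preimage {b}))
      (fun b => ?_) (fun p => ?_) n s
    · rw [abs_of_nonneg (by positivity)]; exact sq_dist_le_sq_diam_univ _ _
    · by_cases hp : p.1 ∈ A m
      · rw [Finset.sum_eq_single (q p.2)]
        · simpa [cellLoss, hem, he, hp] using abs_sq_dist_sub_sq_dist_le p.2 (q p.2) (z m)
        · intro b _ hb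
          rw [Set.indicator_of_notMem, mul_zero]
          exact fun h => hb h.2.symm
        · exact fun h => absurd (q.mem_range_self p.2) h
      · simp [cellLoss, hem, hp]
  refine (Finset.sum_le_sum fun m _ => hcell m).trans_eq ?_
  rw [Finset.sum_add_distrib, Finset.sum_add_distrib, ← empiricalMean_sum,
    ← integral_finsetSum _ fun m _ => hemint m, ← Finset.mul_sum]
  simp only [hem_sum]

/-- Uniformly in the points at which they are evaluated, the total deviation of the cellwise
empirical Fréchet functionals is bounded by random variables with small means, as soon as the
number of cells is negligible with respect to the sample size. -/
theorem exists_integrable_bound_cellLoss [Nonempty 𝒴] [IsProbabilityMeasure P]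
    {Z : ℕ → Ω → 𝒳 × 𝒴} {Q : Measure (𝒳 × 𝒴)}
    (hZ : ∀ i, AEMeasurable (Z i) P) (hQ : ∀ i, P.map (Z i) = Q) (hindep : iIndepFun Z P)
    {M : ℕ → ℕ} (hM : Tendsto (fun n => (M n : ℝ) / n) atTop (𝓝 0))
    {A : (n : ℕ) → Fin (M n) → Set 𝒳} (hA : ∀ n, IsMeasurablePartition (A n))
    {ε : ℝ} (hε : 0 < ε) :
    ∃ R : ℕ → Ω → ℝ, (∀ n, Integrable (R n) P) ∧
      (∀ n ω (z : Fin (M n) → 𝒴), ∑ m, |empiricalMean n (fun i => Z i ω) (cellLoss (A n m) (z m)) -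
        ∫ e, cellLoss (A n m) (z m) e ∂Q| ≤ R n ω) ∧
      ∀ᶠ n in atTop, ∫ ω, R n ω ∂P ≤ ε := by
  have hQp : IsProbabilityMeasure Q := hQ 0 ▸ Measure.isProbabilityMeasure_map (hZ 0)
  set D := Metric.diam (Set.univ : Set 𝒴) with hD
  have hD0 : 0 ≤ D := Metric.diam_nonneg
  -- This choice makes `∫ e ≤ 2D · ε / (8(D + 1)) ≤ ε / 4`. The error counts twice, once in the
  -- empirical mean and once in `Q`, which leaves `ε / 2` for the frequencies.
  obtain ⟨q, hq⟩ := exists_simpleFunc_integral_dist_lt (Q.map Prod.snd)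
    (show 0 < ε / (8 * (D + 1)) by positivity)
  set e : 𝒳 × 𝒴 → ℝ := fun p => 2 * D * dist p.2 (q p.2) with he
  have hdm : Measurable fun y => dist y (q y) := measurable_id.dist q.measurable
  have heint : Integrable e Q :=
    ((integrable_dist_simpleFunc (Q.map Prod.snd) q).comp_measurable measurable_snd).const_mul _
  have heI : ∫ p, e p ∂Q ≤ ε / 4 := by
    rw [integral_map measurable_snd.aemeasurable hdm.aestronglyMeasurable,
      lt_div_iff₀ (by positivity)] at hq
    have h0 : 0 ≤ ∫ p, dist p.2 (q p.2) ∂Q := integral_nonneg fun _ => dist_nonneg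
    rw [he, integral_const_mul]
    nlinarith
  let C : (n : ℕ) → Fin (M n) → 𝒴 → Set (𝒳 × 𝒴) := fun n m b => A n m ×ˢ (q ⁻¹' {b})
  have hC : ∀ n m b, MeasurableSet (C n m b) := fun n m b =>
    ((hA n).measurableSet m).prod (q.measurableSet_preimage {b})
  let Δ : (n : ℕ) → Fin (M n) → 𝒴 → Ω → ℝ := fun n m b ω =>
    |empiricalMean n (fun i => Z i ω) ((C n m b).indicator 1) - Q.real (C n m b)|
  have hΔ : ∀ n m b, Integrable (Δ n m b) P := fun n m b =>
    ((integrable_empiricalMean hZ hQ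
      ((integrable_const (1 : ℝ)).indicator (hC n m b)) n).sub (integrable_const _)).abs
  have hE : ∀ n, Integrable (fun ω => empiricalMean n (fun i => Z i ω) e) P :=
    integrable_empiricalMean hZ hQ heint
  have hE' : ∀ n, Integrable (fun ω => empiricalMean n (fun i => Z i ω) e + ∫ p, e p ∂Q) P :=
    fun n => (hE n).add (integrable_const _)
  have hΔs : ∀ n, Integrable (fun ω => D ^ 2 * ∑ m, ∑ b ∈ q.range, Δ n m b ω) P := fun n =>
    (integrable_finsetSum _ fun m _ => integrable_finsetSum _ fun b _ => hΔ n m b).const_mul _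
  refine ⟨fun n ω => empiricalMean n (fun i => Z i ω) e + ∫ p, e p ∂Q +
    D ^ 2 * ∑ m, ∑ b ∈ q.range, Δ n m b ω,
    fun n => (hE' n).add (hΔs n),
    fun n ω z => sum_abs_empiricalMean_cellLoss_sub_le Q (hA n) q n _ z, ?_⟩
  have hsum : ∀ n, n ≠ 0 → ∀ b, ∑ m, ∫ ω, Δ n m b ω ∂P ≤ √((M n : ℝ) / n) := fun n hn b => by
    have h1 : ∑ m, ∫ ω, Δ n m b ω ∂P ≤ ∑ m, √(Q.real (C n m b) / n) :=
      Finset.sum_le_sum fun m _ =>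
        integral_abs_empiricalMean_indicator_sub_le hZ hQ hindep (hC n m b) hn
    -- Cauchy–Schwarz: `(∑ₘ √(pₘ/n))² ≤ M ∑ₘ pₘ/n ≤ M/n`, because the sets `C n m b` are disjoint in
    -- `m`.
    refine h1.trans (Real.le_sqrt_of_sq_le (sq_sum_le_card_mul_sum_sq.trans ?_))
    have h2 : ∑ m, Q.real (C n m b) ≤ 1 := by
      rw [← measureReal_iUnion_fintype (fun i j hij => ?_) (hC n · b)]
      · exact measureReal_le_one
      · exact Set.Disjoint.set_prod_left ((hA n).disjoint hij) _ _
    have h3 : ∀ m, √(Q.real (C n m b) / n) ^ 2 = Q.real (C n m b) / n := fun m =>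
      Real.sq_sqrt (by positivity)
    simp only [h3, Finset.card_univ, Fintype.card_fin, ← Finset.sum_div]
    rw [← mul_div_assoc]
    gcongr
    nlinarith [(M n).cast_nonneg (α := ℝ)]
  have hlim : Tendsto (fun n => D ^ 2 * (q.range.card * √((M n : ℝ) / n))) atTop (𝓝 0) := by
    simpa using (((Real.continuous_sqrt.tendsto 0).comp hM).const_mul
      (q.range.card : ℝ)).const_mul (D ^ 2)
  filter_upwards [hlim.eventually_le_const (show 0 < ε / 2 by positivity), eventually_ne_atTop 0]
    with n hn hn0
  rw [integral_add (hE' n) (hΔs n),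
    integral_add (hE n) (integrable_const _), integral_empiricalMean hZ hQ heint hn0,
    integral_const_mul (D ^ 2), integral_finsetSum _ fun m _ => integrable_finsetSum _ fun b _ => hΔ n m b]
  simp only [integral_finsetSum q.range fun b _ => hΔ n _ b, integral_const, probReal_univ,
    one_smul]
  rw [Finset.sum_comm]
  have h4 : ∑ b ∈ q.range, ∑ m, ∫ ω, Δ n m b ω ∂P ≤ q.range.card * √((M n : ℝ) / n) := by
    rw [← nsmul_eq_mul]
    exact Finset.sum_le_card_nsmul _ _ _ fun b _ => hsum n hn0 b
  have h5 := mul_le_mul_of_nonneg_left h4 (sq_nonneg D)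
  linarith

end Uniform

/-! ### From uniform deviations to minimal values -/

section Minima

variable {Ω 𝒳 𝒴 : Type*} [MeasurableSpace Ω] {P : Measure Ω} [MeasurableSpace 𝒳]
  [MetricSpace 𝒴] [BoundedSpace 𝒴] [SecondCountableTopology 𝒴] [MeasurableSpace 𝒴] [BorelSpace 𝒴]

/-- Consistency of the pooled minimal values of the cellwise empirical Fréchet functionals. -/
theorem tendstoInMeasure_sum_empiricalMean_cellLoss [Nonempty 𝒴] [IsProbabilityMeasure P]
    {Z : ℕ → Ω → 𝒳 × 𝒴} {Q : Measure (𝒳 × 𝒴)}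
    (hZ : ∀ i, AEMeasurable (Z i) P) (hQ : ∀ i, P.map (Z i) = Q) (hindep : iIndepFun Z P)
    {M : ℕ → ℕ} (hM : Tendsto (fun n => (M n : ℝ) / n) atTop (𝓝 0))
    {A : (n : ℕ) → Fin (M n) → Set 𝒳} (hA : ∀ n, IsMeasurablePartition (A n))
    {μ : (n : ℕ) → Fin (M n) → 𝒴}
    (hμ : ∀ n m z, ∫ e, cellLoss (A n m) (μ n m) e ∂Q ≤ ∫ e, cellLoss (A n m) z e ∂Q)
    {μhat : (n : ℕ) → Fin (M n) → Ω → 𝒴}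
    (hμhat : ∀ n m, ∀ᵐ ω ∂P, ∀ z,
      empiricalMean n (fun i => Z i ω) (cellLoss (A n m) (μhat n m ω)) ≤
        empiricalMean n (fun i => Z i ω) (cellLoss (A n m) z))
    {c : ℝ} (hc : Tendsto (fun n => ∑ m, ∫ e, cellLoss (A n m) (μ n m) e ∂Q) atTop (𝓝 c)) :
    TendstoInMeasure P
      (fun n ω => ∑ m, empiricalMean n (fun i => Z i ω) (cellLoss (A n m) (μhat n m ω)))
      atTop (fun _ => c) := by
  rw [tendstoInMeasure_iff_measureReal_dist]
  intro ε hε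
  refine tendsto_order.2 ⟨fun a ha => Eventually.of_forall fun n => ha.trans_le measureReal_nonneg,
    fun δ hδ => ?_⟩
  obtain ⟨R, hRint, hR, hRlim⟩ := exists_integrable_bound_cellLoss hZ hQ hindep hM hA
    (show 0 < ε / 2 * (δ / 2) by positivity)
  filter_upwards [hRlim, Metric.tendsto_nhds.1 hc (ε / 2) (by positivity)] with n hn hcn
  have hR0 : ∀ ω, 0 ≤ R n ω := fun ω =>
    (Finset.sum_nonneg fun m _ => abs_nonneg _).trans (hR n ω (μ n))
  have hmarkov := mul_meas_ge_le_integral_of_nonneg (ae_of_all P hR0) (hRint n) (ε / 2)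
  -- The minimizers `μhat` need not be measurable, so Markov's inequality is applied to the
  -- integrable bound `R` instead.
  have hsub : P.real {ω | ε ≤ dist (∑ m, empiricalMean n (fun i => Z i ω)
      (cellLoss (A n m) (μhat n m ω))) c} ≤ P.real {ω | ε / 2 ≤ R n ω} := by
    refine ENNReal.toReal_mono (measure_ne_top _ _) (measure_mono_ae ?_)
    filter_upwards [ae_all_iff.2 (hμhat n)] with ω hω hlarge
    change ε ≤ dist _ _ at hlarge
    change ε / 2 ≤ R n ω
    -- Each minimizer is tested in the other functional: empirical minimum ≤ empirical value at `μ`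
    -- ≤ population minimum + `R`, and symmetrically at `μhat`.
    have hle : |∑ m, empiricalMean n (fun i => Z i ω) (cellLoss (A n m) (μhat n m ω)) -
        ∑ m, ∫ e, cellLoss (A n m) (μ n m) e ∂Q| ≤ R n ω := by
      have hdev : ∀ z : Fin (M n) → 𝒴,
          |∑ m, empiricalMean n (fun i => Z i ω) (cellLoss (A n m) (z m)) -
            ∑ m, ∫ e, cellLoss (A n m) (z m) e ∂Q| ≤ R n ω := fun z => by
        rw [← Finset.sum_sub_distrib]
        exact (Finset.abs_sum_le_sum_abs _ _).trans (hR n ω z)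
      have h1 := abs_le.1 (hdev (μ n))
      have h2 := abs_le.1 (hdev fun m => μhat n m ω)
      have h3 := Finset.sum_le_sum fun m (_ : m ∈ Finset.univ) => hω m (μ n m)
      have h4 := Finset.sum_le_sum fun m (_ : m ∈ Finset.univ) => hμ n m (μhat n m ω)
      rw [abs_le]
      constructor <;> linarith [h1.1, h1.2, h2.1, h2.2]
    have htri := dist_triangle (∑ m, empiricalMean n (fun i => Z i ω)
      (cellLoss (A n m) (μhat n m ω))) (∑ m, ∫ e, cellLoss (A n m) (μ n m) e ∂Q) c
    rw [Real.dist_eq (∑ m, empiricalMean n (fun i => Z i ω)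
      (cellLoss (A n m) (μhat n m ω))) (∑ m, ∫ e, cellLoss (A n m) (μ n m) e ∂Q)] at htri
    linarith
  exact (hsub.trans (le_of_mul_le_mul_left (hmarkov.trans hn) (by positivity))).trans_lt
    (half_lt_self hδ)

end Minima

/-- Continuous mapping theorem for convergence in measure to constants. -/
theorem tendstoInMeasure_comp₂_of_continuousAt {Ω : Type*} [MeasurableSpace Ω] {P : Measure Ω}
    {f g : ℕ → Ω → ℝ} {a b : ℝ} {φ : ℝ × ℝ → ℝ}
    (hf : TendstoInMeasure P f atTop fun _ => a) (hg : TendstoInMeasure P g atTop fun _ => b)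
    (hφ : ContinuousAt φ (a, b)) :
    TendstoInMeasure P (fun n ω => φ (f n ω, g n ω)) atTop fun _ => φ (a, b) := by
  rw [tendstoInMeasure_iff_dist] at *
  intro ε hε
  obtain ⟨δ, hδ, h⟩ := Metric.continuousAt_iff.1 hφ ε hε
  have hsum := (hf δ hδ).add (hg δ hδ)
  rw [add_zero] at hsum
  refine tendsto_of_tendsto_of_tendsto_of_le_of_le tendsto_const_nhds hsum
    (fun n => zero_le) fun n => ?_
  refine (measure_mono fun ω hω => ?_).trans (measure_union_le _ _)
  by_contra hcon
  rw [Set.mem_union, not_or] at hcon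
  simp only [Set.mem_ofPred_eq, not_le] at hcon hω
  exact absurd (h (max_lt hcon.1 hcon.2)) (not_lt.2 hω)

/-! ### The estimator in terms of empirical means -/

theorem card_div_mul_sampleFrechetFun {𝒳 𝒴 : Type*} [MetricSpace 𝒴]
    (n : ℕ) (x : ℕ → 𝒳) (y : ℕ → 𝒴) (A : Set 𝒳) (z : 𝒴) :
    ((cellIndices n x A).card : ℝ) / n * sampleFrechetFun (cellIndices n x A) y z =
      empiricalMean n (fun i => (x i, y i)) (cellLoss A z) := by
  classical
  have hsum : ∑ i ∈ cellIndices n x A, dist (y i) z ^ 2 =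
      ∑ i ∈ Finset.range n, cellLoss A z (x i, y i) := by
    simp only [cellIndices, cellLoss, Finset.sum_filter, Set.indicator_apply]
  rw [sampleFrechetFun, empiricalMean, ← hsum]
  -- For an empty cell both sides vanish; otherwise the cell count cancels.
  rcases Finset.eq_empty_or_nonempty (cellIndices n x A) with h | h
  · simp [h]
  · have : ((cellIndices n x A).card : ℝ) ≠ 0 := by exact_mod_cast h.card_ne_zero
    field_simp

theorem sampleFrechetFun_range {𝒳 𝒴 : Type*} [MetricSpace 𝒴]
    (n : ℕ) (x : ℕ → 𝒳) (y : ℕ → 𝒴) (z : 𝒴) :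
    sampleFrechetFun (Finset.range n) y z =
      empiricalMean n (fun i => (x i, y i)) (cellLoss Set.univ z) := by
  simp [sampleFrechetFun, empiricalMean, cellLoss]

/-! ### Population functionals and disintegration along the predictor -/

section Population

variable {Ω 𝒳 𝒴 : Type*} [MeasurableSpace Ω] {P : Measure Ω} [MeasurableSpace 𝒳]
  [MetricSpace 𝒴] [SecondCountableTopology 𝒴] [MeasurableSpace 𝒴] [BorelSpace 𝒴]
  {X : Ω → 𝒳} {Y : Ω → 𝒴}

theorem frechetFun_map (hY : AEMeasurable Y P) (z : 𝒴) :
    frechetFun (P.map Y) z = ∫ ω, dist (Y ω) z ^ 2 ∂P :=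
  integral_map hY (by fun_prop)

theorem integral_cellLoss_map (hX : Measurable X) (hY : Measurable Y) {A : Set 𝒳}
    (hA : MeasurableSet A) (z : 𝒴) :
    ∫ e, cellLoss A z e ∂(P.map fun ω => (X ω, Y ω)) =
      ∫ ω in X ⁻¹' A, dist (Y ω) z ^ 2 ∂P := by
  rw [integral_map (hX.prodMk hY).aemeasurable (measurable_cellLoss hA z).aestronglyMeasurable,
    ← integral_indicator (hX hA)]
  rfl

theorem integral_cellLoss_univ_map (hX : Measurable X) (hY : Measurable Y) (z : 𝒴) :
    ∫ e, cellLoss Set.univ z e ∂(P.map fun ω => (X ω, Y ω)) = frechetFun (P.map Y) z := by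
  rw [integral_cellLoss_map hX hY MeasurableSet.univ, Set.preimage_univ, Measure.restrict_univ,
    frechetFun_map hY.aemeasurable]

variable [IsFiniteMeasure P]

/-- The restricted Fréchet functional is a multiple of the Fréchet functional of the conditional
law given the cell. -/
theorem integral_cellLoss_map_eq_mul (hX : Measurable X) (hY : Measurable Y) {A : Set 𝒳}
    (hA : MeasurableSet A) (z : 𝒴) :
    ∫ e, cellLoss A z e ∂(P.map fun ω => (X ω, Y ω)) =
      P.real (X ⁻¹' A) * frechetFun ((P[|X ⁻¹' A]).map Y) z := by
  rw [integral_cellLoss_map hX hY hA, frechetFun_map hY.aemeasurable, ProbabilityTheory.cond,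
    integral_smul_measure, ENNReal.toReal_inv, smul_eq_mul, ← measureReal_def]
  -- On a null cell the restricted measure is zero, so both sides vanish whatever the conditional
  -- law is.
  by_cases h : P.real (X ⁻¹' A) = 0
  · rw [measureReal_eq_zero_iff] at h
    simp [Measure.restrict_eq_zero.2 h]
  · field_simp

variable [BoundedSpace 𝒴]

theorem continuous_frechetFun (ν : Measure 𝒴) [IsFiniteMeasure ν] : Continuous (frechetFun ν) :=
  continuous_of_dominated (fun z => (integrable_sq_dist ν z).aestronglyMeasurable)
    (fun z => ae_of_all _ fun y => by
      rw [Real.norm_of_nonneg (by positivity)]; exact sq_dist_le_sq_diam_univ _ _)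
    (integrable_const _) (ae_of_all _ fun y => by fun_prop)

/-- Cellwise centers that approximate the conditional Fréchet means uniformly have a pooled
Fréchet variance that converges to the mean of the conditional Fréchet variance. -/
theorem tendsto_sum_integral_cellLoss [Nonempty 𝒴] [StandardBorelSpace 𝒴]
    (hX : Measurable X) (hY : Measurable Y)
    {M : ℕ → ℕ} {A : (n : ℕ) → Fin (M n) → Set 𝒳} (hA : ∀ n, IsMeasurablePartition (A n))
    (μ : (n : ℕ) → Fin (M n) → 𝒴) (μx : 𝒳 → 𝒴)
    (happrox : Tendsto
      (fun n => ⨆ m : Fin (M n),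
        essSup (fun x => edist (μ n m) (μx x)) ((P.map X).restrict (A n m)))
      atTop (𝓝 0)) :
    Tendsto (fun n => ∑ m, ∫ e, cellLoss (A n m) (μ n m) e ∂(P.map fun ω => (X ω, Y ω))) atTop
      (𝓝 (∫ ω, frechetFun (condDistrib Y X P (X ω)) (μx (X ω)) ∂P)) := by
  set Q := P.map fun ω => (X ω, Y ω) with hQ
  set D := Metric.diam (Set.univ : Set 𝒴) with hD
  have hloss : ∀ n m, Integrable (cellLoss (A n m) (μ n m)) Q := fun n m =>
    integrable_cellLoss Q ((hA n).measurableSet m) _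
  let f : ℕ → 𝒳 × 𝒴 → ℝ := fun n e => ∑ m, cellLoss (A n m) (μ n m) e
  have hfint : ∀ n, Integrable (f n) Q := fun n => integrable_finsetSum _ fun m _ => hloss n m
  have hfm : ∀ n x m, x ∈ A n m → ∀ y, f n (x, y) = dist y (μ n m) ^ 2 := fun n x m hx y =>
    (hA n).sum_indicator hx fun m _ => dist y (μ n m) ^ 2
  have hinner : ∀ n x m, x ∈ A n m →
      ∫ y, f n (x, y) ∂condDistrib Y X P x = frechetFun (condDistrib Y X P x) (μ n m) :=
    fun n x m hx => by simp only [hfm n x m hx, frechetFun]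
  have hmeas : ∀ n, AEStronglyMeasurable
      (fun x => ∫ y, f n (x, y) ∂condDistrib Y X P x) (P.map X) := fun n =>
    (hfint n).aestronglyMeasurable.integral_condDistrib_map hY.aemeasurable
  have heq : ∀ n, ∑ m, ∫ e, cellLoss (A n m) (μ n m) e ∂Q =
      ∫ ω, ∫ y, f n (X ω, y) ∂condDistrib Y X P (X ω) ∂P := fun n => by
    have hfint' := hfint n
    rw [← integral_finsetSum _ fun m _ => hloss n m]
    change ∫ e, f n e ∂Q = _
    rw [hQ, ← compProd_map_condDistrib hY.aemeasurable] at hfint' ⊢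
    rw [Measure.integral_compProd hfint', integral_map hX.aemeasurable (hmeas n)]
  simp only [heq]
  -- There are countably many pairs `(n, m)`, so a single null set serves all of them.
  have hclose : ∀ᵐ x ∂(P.map X), ∀ n m, x ∈ A n m → edist (μ n m) (μx x) ≤
      ⨆ m : Fin (M n), essSup (fun x => edist (μ n m) (μx x)) ((P.map X).restrict (A n m)) := by
    refine ae_all_iff.2 fun n => ae_all_iff.2 fun m => ?_
    have h := ENNReal.ae_le_essSup (μ := (P.map X).restrict (A n m))
      fun x => edist (μ n m) (μx x)
    rw [ae_restrict_iff' ((hA n).measurableSet m)] at h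
    filter_upwards [h] with x hx hxm
    exact (hx hxm).trans (le_iSup (fun m : Fin (M n) =>
      essSup (fun x => edist (μ n m) (μx x)) ((P.map X).restrict (A n m))) m)
  refine tendsto_integral_of_dominated_convergence (fun _ => D ^ 2)
    (fun n => (hmeas n).comp_measurable hX) (integrable_const _)
    (fun n => ae_of_all _ fun ω => ?_) ?_
  · obtain ⟨m, hm⟩ := (hA n).exists_mem (X ω)
    simp only [hinner n (X ω) m hm, frechetFun]
    refine (norm_integral_le_of_norm_le_const (C := D ^ 2) (ae_of_all _ fun y => ?_)).trans ?_
    · rw [Real.norm_of_nonneg (by positivity)]; exact sq_dist_le_sq_diam_univ _ _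
    · simp
  · filter_upwards [ae_of_ae_map hX.aemeasurable hclose] with ω hω
    -- With `ω` fixed, the conditional law is fixed and only the centre of the cell containing `X ω`
    -- moves, so continuity of `frechetFun` suffices.
    choose m hm using fun n => (hA n).exists_mem (X ω)
    simp only [fun n => hinner n (X ω) (m n) (hm n)]
    refine ((continuous_frechetFun _).tendsto _).comp (tendsto_iff_edist_tendsto_0.2 ?_)
    exact tendsto_of_tendsto_of_tendsto_of_le_of_le tendsto_const_nhds happrox
      (fun n => zero_le) fun n => hω n _ (hm n)

end Population

end FCC

/-! ### Assembly of numerator, denominator and quotient -/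

theorem mainTheorem4
    {Ω 𝒳 𝒴 : Type*} [MeasurableSpace Ω] (P : Measure Ω) [IsProbabilityMeasure P]
    -- the bounded, complete, separable metric spaces of predictors and of responses
    [MetricSpace 𝒳] [BoundedSpace 𝒳] [CompleteSpace 𝒳] [SecondCountableTopology 𝒳]
    [MeasurableSpace 𝒳] [BorelSpace 𝒳]
    [MetricSpace 𝒴] [BoundedSpace 𝒴] [CompleteSpace 𝒴] [SecondCountableTopology 𝒴]
    [MeasurableSpace 𝒴] [BorelSpace 𝒴] [Nonempty 𝒴]
    -- the pair `(X, Y)` and i.i.d. copies `(Xs i, Ys i)` of it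
    (X : Ω → 𝒳) (Y : Ω → 𝒴) (hX : Measurable X) (hY : Measurable Y)
    (Xs : ℕ → Ω → 𝒳) (Ys : ℕ → Ω → 𝒴)
    (hindep : iIndepFun (fun i ω => (Xs i ω, Ys i ω)) P)
    (hident : ∀ i, IdentDistrib (fun ω => (Xs i ω, Ys i ω)) (fun ω => (X ω, Y ω)) P P)
    -- the measurable partitions into `M n` cells, with `M n = o(n)`
    (M : ℕ → ℕ) (hM : Tendsto (fun n => (M n : ℝ) / n) atTop (𝓝 0))
    (cell : (n : ℕ) → Fin (M n) → Set 𝒳)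
    (hcell : ∀ n, FCC.IsMeasurablePartition (cell n))
    -- existence and uniqueness of the global and of the conditional Fréchet means
    (μF : 𝒴) (hμF : FCC.IsUniqueFrechetMean (P.map Y) μF)
    (μFx : 𝒳 → 𝒴)
    (hμFx : ∀ᵐ x ∂(P.map X), FCC.IsUniqueFrechetMean (condDistrib Y X P x) (μFx x))
    -- balanced cells
    (hbal : FCC.IsBalanced (P.map X) M cell)
    -- geodesic convexity, and existence and uniqueness of the cellwise Fréchet means
    (hconv : ∀ᵐ y ∂(P.map Y), FCC.GeodesicallyConvex (fun z : 𝒴 => dist z y ^ 2))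
    (μFm : (n : ℕ) → Fin (M n) → 𝒴)
    (hμFm : ∀ n m, FCC.IsUniqueFrechetMean ((P[|X ⁻¹' cell n m]).map Y) (μFm n m))
    -- uniform approximation of the conditional means by the cellwise means
    (happrox : Tendsto
      (fun n => ⨆ m : Fin (M n),
        essSup (fun x => edist (μFm n m) (μFx x)) ((P.map X).restrict (cell n m)))
      atTop (𝓝 0))
    -- the global and the cellwise sample Fréchet means
    (μhat : ℕ → Ω → 𝒴)
    (hμhat : ∀ n, ∀ᵐ ω ∂P,
      FCC.IsSampleFrechetMean (Finset.range n) (fun i => Ys i ω) (μhat n ω))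
    (μhatm : (n : ℕ) → Fin (M n) → Ω → 𝒴)
    (hμhatm : ∀ n m, ∀ᵐ ω ∂P,
      FCC.IsSampleFrechetMean (FCC.cellIndices n (fun i => Xs i ω) (cell n m))
        (fun i => Ys i ω) (μhatm n m ω)) :
    TendstoInMeasure P
      (fun n ω => FCC.fccEstimator n (fun i => Xs i ω) (fun i => Ys i ω) (cell n)
        (μhat n ω) (fun m => μhatm n m ω))
      atTop (fun _ => FCC.fcc P X Y μF μFx) := by
  have hZ : ∀ i, AEMeasurable (fun ω => (Xs i ω, Ys i ω)) P := fun i => (hident i).aemeasurable_fst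
  have hQ : ∀ i, P.map (fun ω => (Xs i ω, Ys i ω)) = P.map (fun ω => (X ω, Y ω)) :=
    fun i => (hident i).map_eq
  have hnum : TendstoInMeasure P
      (fun n ω => ∑ m, FCC.empiricalMean n (fun i => (Xs i ω, Ys i ω))
        (FCC.cellLoss (cell n m) (μhatm n m ω)))
      atTop (fun _ => ∫ ω, FCC.frechetFun (condDistrib Y X P (X ω)) (μFx (X ω)) ∂P) := by
    refine FCC.tendstoInMeasure_sum_empiricalMean_cellLoss hZ hQ hindep hM hcell (μ := μFm)
      (fun n m z => ?_) (fun n m => ?_)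
      (FCC.tendsto_sum_integral_cellLoss hX hY hcell μFm μFx happrox)
    · rw [FCC.integral_cellLoss_map_eq_mul hX hY ((hcell n).measurableSet m),
        FCC.integral_cellLoss_map_eq_mul hX hY ((hcell n).measurableSet m)]
      exact mul_le_mul_of_nonneg_left ((hμFm n m).1 z) measureReal_nonneg
    · filter_upwards [hμhatm n m] with ω hω z
      rw [← FCC.card_div_mul_sampleFrechetFun, ← FCC.card_div_mul_sampleFrechetFun]
      exact mul_le_mul_of_nonneg_left (hω z) (by positivity)
  have huniv : FCC.IsMeasurablePartition (fun _ : Fin 1 => (Set.univ : Set 𝒳)) :=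
    ⟨fun _ => MeasurableSet.univ, fun i j hij => absurd (Subsingleton.elim i j) hij,
      Set.iUnion_const _⟩
  have hhat : ∀ n, ∀ᵐ ω ∂P, ∀ z,
      FCC.empiricalMean n (fun i => (Xs i ω, Ys i ω)) (FCC.cellLoss Set.univ (μhat n ω)) ≤
        FCC.empiricalMean n (fun i => (Xs i ω, Ys i ω)) (FCC.cellLoss Set.univ z) := fun n => by
    filter_upwards [hμhat n] with ω hω z
    simpa only [FCC.sampleFrechetFun_range n fun i => Xs i ω] using hω z
  have hden : TendstoInMeasure P
      (fun n ω => FCC.empiricalMean n (fun i => (Xs i ω, Ys i ω))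
        (FCC.cellLoss Set.univ (μhat n ω)))
      atTop (fun _ => FCC.frechetFun (P.map Y) μF) := by
    have h := FCC.tendstoInMeasure_sum_empiricalMean_cellLoss hZ hQ hindep (M := fun _ => 1)
      (A := fun _ _ => Set.univ) (μ := fun _ _ => μF) (μhat := fun n _ => μhat n)
      (c := FCC.frechetFun (P.map Y) μF)
      (by simpa using tendsto_inv_atTop_nhds_zero_nat (𝕜 := ℝ)) (fun _ => huniv)
      (fun n m z => ?_) (fun n _ => hhat n) ?_
    · simpa using h
    · simp only [FCC.integral_cellLoss_univ_map hX hY]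
      exact hμF.1 z
    · simp [FCC.integral_cellLoss_univ_map hX hY]
  simp only [FCC.fccEstimator, FCC.fcc, FCC.card_div_mul_sampleFrechetFun,
    fun n ω z => FCC.sampleFrechetFun_range n (fun i => Xs i ω) (fun i => Ys i ω) z]
  -- If `V_F = 0`, the nonnegative empirical functional at `μF` has mean zero, so it and the sample
  -- minimum vanish almost surely. Since division by zero gives `0`, the estimator and the
  -- coefficient both equal `1`.
  by_cases hV : FCC.frechetFun (P.map Y) μF = 0
  · have hzero : ∀ᶠ n in atTop, (fun _ : Ω => (1 : ℝ)) =ᵐ[P] fun ω =>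
        1 - (∑ m, FCC.empiricalMean n (fun i => (Xs i ω, Ys i ω))
          (FCC.cellLoss (cell n m) (μhatm n m ω))) /
          FCC.empiricalMean n (fun i => (Xs i ω, Ys i ω))
            (FCC.cellLoss Set.univ (μhat n ω)) := by
      filter_upwards [eventually_ne_atTop 0] with n hn
      have hint := FCC.integrable_cellLoss (P.map fun ω => (X ω, Y ω))
        (MeasurableSet.univ : MeasurableSet (Set.univ : Set 𝒳)) μF
      have hI := FCC.integral_empiricalMean hZ hQ hint hn
      have hnonneg : ∀ ω z, 0 ≤ FCC.empiricalMean n (fun i => (Xs i ω, Ys i ω))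
          (FCC.cellLoss Set.univ z) := fun ω z =>
        mul_nonneg (by positivity) (Finset.sum_nonneg fun i _ => FCC.cellLoss_nonneg _ _ _)
      rw [FCC.integral_cellLoss_univ_map hX hY, hV, integral_eq_zero_iff_of_nonneg
        (fun ω => hnonneg ω μF) (FCC.integrable_empiricalMean hZ hQ hint n)] at hI
      filter_upwards [hI, hhat n] with ω h0 hω
      rw [le_antisymm ((hω μF).trans_eq h0) (hnonneg ω _), Pi.zero_apply,
        div_zero, sub_zero]
    rw [hV, div_zero, sub_zero]
    exact TendstoInMeasure.congr' hzero EventuallyEq.rfl fun ε hε => by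
      simp [hε.not_ge]
  · exact FCC.tendstoInMeasure_comp₂_of_continuousAt (φ := fun p => 1 - p.1 / p.2) hnum hden
      (continuousAt_const.sub (continuousAt_fst.div continuousAt_snd hV))
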